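/- **Conventions.** Let $m\in\mathbb N$ and let $x:\{|z|=1\}\to M_m(\mathbb C)$ be continuous, with Fourier coefficients $x_r=\frac1{2\pi}\int_{-\pi}^{\pi}x(e^{ik})e^{-irk}\,dk$, $r\in\mathbb Z$. For $N\ge 1$ let $X_N=(x_{j-i})_{1\le i,j\le N}$ be the $mN\times mN$ block-Toeplitz matrix with symbol $x$. Let $X=(x_{j-i})_{i,j\ge 1}$ be the block-Toeplitz operator, a bounded operator on $\ell^2(\mathbb Z_{>0})\otimes\mathbb C^m$, and let $\widetilde X=(x_{i-j})_{i,j\ge1}$ be the associated block-Toeplitz operator, whose symbol is $\widetilde x(z)=x(1/z)$. The uniform limiting set $\lim_{n\to\infty}A_n$ of sets $A_n\subseteq\mathbb C$ is the set of all $\lambda\in\mathbb C$ for which there are $\lambda_n\in A_n$ (for all $n$) with $\lambda_n\to\lambda$. $\sigma$ denotes the spectrum. **Theorem.** For every continuous symbol $x$, $$\lim_{N\to\infty}\sigma(X_N)\subseteq\sigma(X)\cup\sigma(\widetilde X).$$ **Corollary (stability gaps).** Consider a one-dimensional bulk-translationally invariant quadratic bosonic Lindbladian with $d\ge1$ bosonic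 modes per site and finite-range couplings. That is, let $h_r,m_r\in M_{2d}(\mathbb C)$, $r\in\mathbb Z$, vanish for $|r|>R$ and satisfy $h_r^\dagger=h_{-r}$, $m_r^\dagger=m_{-r}$, $h_r=\tau_1h_r^*\tau_1$, where $*$ is entrywise complex conjugation and $\tau_k=1_d\otimes\sigma_k$ with $\sigma_k$ the Pauli matrices, and suppose that the block matrix $M_N=(m_{j-i})_{1\le i,j\le N}$ is positive semidefinite for every $N$. Put $H_N=(h_{j-i})_{1\le i,j\le N}$ and let $$G_N^{\rm OBC}=\tau_3H_N-\tfrac i2\,\tau_3\,(M_N-\tau_1M_N^{T}\tau_1)$$ be the dynamical matrix of the open chain of $N$ sites (here $\tau_k$ stands for $1_N\otimes\tau_k$). It is block-Toeplitz with blocks $g_{j-i}$, where $g_r=\tau_3h_r-\frac i2\tau_3(m_r-\tau_1m_r^*\tau_1)$. Let $G^{\rm SIBC}$ be the operator on $\ell^2(\mathbb Z)\otimes\mathbb C^{2d}$ whose $(i,j)$ block is $g_{j-i}$ if $i,j\ge1$ or $i,j\le0$, and $0$ otherwise (two disjoint half-infinite chains). Define the stability gaps $\Delta_{S,N}^{\rm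 OBC}=\max\operatorname{Re}\sigma(-iG_N^{\rm OBC})$ and $\Delta_S^{\rm SIBC}=\max\operatorname{Re}\sigma(-iG^{\rm SIBC})$. Then $$\limsup_{N\to\infty}\Delta_{S,N}^{\rm OBC}\le\Delta_S^{\rm SIBC};$$ in particular, if $\Delta_{S,\infty}^{\rm OBC}=\lim_{N\to\infty}\Delta_{S,N}^{\rm OBC}$ exists, then $\Delta_{S,\infty}^{\rm OBC}\le\Delta_S^{\rm SIBC}$. -/

import Mathlib

open Filter Topology MeasureTheory AddCircle
open scoped Matrix Kronecker ENNReal ComplexOrder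

noncomputable section

namespace BlockToeplitz

/-! ### Symbols and their Fourier coefficients -/

/-- A continuous matrix-valued symbol `x(z)`, `|z| = 1`, with blocks indexed by `ι`. -/
abbrev Symbol (ι : Type) : Type := C(Circle, Matrix ι ι ℂ)

/-- The matrix entry `θ ↦ x(e^{2πiθ})_{ab}` of a symbol, as a function on `ℝ/ℤ`. -/
def Symbol.entry {ι : Type} (x : Symbol ι) (a b : ι) : C(UnitAddCircle, ℂ) where
  toFun θ := x (AddCircle.toCircle θ) a b
  continuous_toFun := by
    have h : Continuous fun θ : UnitAddCircle => x (AddCircle.toCircle θ) :=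
      x.continuous.comp AddCircle.continuous_toCircle
    exact h.matrix_elem a b

/-- The `r`-th Fourier coefficient `x_r = ∫₀¹ x(e^{2πiθ}) e^{-2πirθ} dθ` of a symbol,
so that `x(z) ∼ ∑ x_r z^r`. -/
def Symbol.coeff {ι : Type} (x : Symbol ι) (r : ℤ) : Matrix ι ι ℂ :=
  Matrix.of fun a b => fourierCoeff (x.entry a b) r

/-- The symbol `x̃(z) = x(1/z)`. -/
def Symbol.assoc {ι : Type} (x : Symbol ι) : Symbol ι where
  toFun z := x z⁻¹
  continuous_toFun := x.continuous.comp continuous_inv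

/-! ### Finite block-Toeplitz matrices -/

/-- The `N × N` block matrix whose `(i, j)` block is `c (j - i)`. -/
def blockToeplitzOf {ι : Type} (c : ℤ → Matrix ι ι ℂ) (N : ℕ) :
    Matrix (Fin N × ι) (Fin N × ι) ℂ :=
  Matrix.of fun p q => c ((q.1 : ℤ) - (p.1 : ℤ)) p.2 q.2

/-- The finite block-Toeplitz matrix `X_N` with symbol `x`. -/
def toeplitzMatrix {ι : Type} (x : Symbol ι) (N : ℕ) : Matrix (Fin N × ι) (Fin N × ι) ℂ :=
  blockToeplitzOf x.coeff N

/-! ### Operators on `ℓ²` -/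

/-- The Hilbert space `ℓ²(α)` of square-summable complex functions on `α`. In particular
`ℓ²(ℤ × ι)` is `ℓ²(ℤ) ⊗ ℂ^ι`. -/
abbrev Ell2 (α : Type) : Type := lp (fun _ : α => ℂ) 2

/-- The canonical basis vector `e_a` of `ℓ²(α)`. -/
def basisVec {α : Type} (a : α) : Ell2 α := by
  classical exact lp.single 2 a (1 : ℂ)

theorem basisVec_eq {α : Type} [DecidableEq α] (a : α) :
    basisVec a = (lp.single 2 a (1 : ℂ) : Ell2 α) := by
  unfold basisVec
  congr!

theorem basisVec_apply_self {α : Type} (a : α) : basisVec a a = 1 := by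
  simp [basisVec]

theorem basisVec_apply_ne {α : Type} {a b : α} (h : b ≠ a) : basisVec a b = 0 := by
  simp [basisVec, lp.single_apply, h]

theorem inner_basisVec {α : Type} (a : α) (ψ : Ell2 α) : inner ℂ (basisVec a) ψ = ψ a := by
  classical
  simp [basisVec, lp.inner_single_left]

theorem orthonormal_basisVec {α : Type} : Orthonormal ℂ (basisVec (α := α)) := by
  classical
  rw [orthonormal_iff_ite]
  intro a b
  rw [inner_basisVec]
  split_ifs with h
  · rw [h, basisVec_apply_self]
  · exact basisVec_apply_ne h

/-- The isometry `ℓ²(α) → ℓ²(β)`, `e_a ↦ e_{f a}`, induced by an injection `f`. -/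
def embed {α β : Type} (f : α ↪ β) : Ell2 α →L[ℂ] Ell2 β :=
  ((orthonormal_basisVec (α := β)).comp f f.injective).orthogonalFamily.linearIsometry.toContinuousLinearMap

theorem embed_basisVec {α β : Type} (f : α ↪ β) (a : α) :
    embed f (basisVec a) = basisVec (f a) := by
  classical
  have := ((orthonormal_basisVec (α := β)).comp f
    f.injective).orthogonalFamily.linearIsometry_apply_single (i := a) (1 : ℂ)
  simp only [embed, LinearIsometry.coe_toContinuousLinearMap]
  rw [basisVec_eq, this]
  simp

/-- The adjoint of `embed f` is the restriction of functions along `f`. -/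
theorem adjoint_embed_apply {α β : Type} (f : α ↪ β) (φ : Ell2 β) (a : α) :
    (ContinuousLinearMap.adjoint (embed f) φ) a = φ (f a) := by
  rw [← inner_basisVec, ContinuousLinearMap.adjoint_inner_right, embed_basisVec, inner_basisVec]

/-- Multiplication by a continuous function on `L²(ℝ/ℤ)`. -/
def mulOp (f : C(UnitAddCircle, ℂ)) :
    Lp ℂ 2 (haarAddCircle (T := 1)) →L[ℂ] Lp ℂ 2 (haarAddCircle (T := 1)) :=
  (ContinuousLinearMap.mul ℂ ℂ).holderL haarAddCircle ∞ 2 2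
    (ContinuousMap.toLp ∞ haarAddCircle ℂ f)

/-- The function `θ ↦ f(-θ)`. -/
def reflect (f : C(UnitAddCircle, ℂ)) : C(UnitAddCircle, ℂ) where
  toFun θ := f (-θ)
  continuous_toFun := f.continuous.comp continuous_neg

/-- The Laurent operator on `ℓ²(ℤ)` whose `(i, j)` matrix entry is the Fourier coefficient
`f_{j-i}`; in the Fourier representation it is multiplication by `f(-θ)`. -/
def laurentScalar (f : C(UnitAddCircle, ℂ)) : Ell2 ℤ →L[ℂ] Ell2 ℤ :=
  (fourierBasis (T := 1)).repr.toContinuousLinearEquiv.toContinuousLinearMap ∘L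
    mulOp (reflect f) ∘L
    (fourierBasis (T := 1)).repr.symm.toContinuousLinearEquiv.toContinuousLinearMap

/-- The inclusion of the `a`-th internal component. -/
def component {ι : Type} (a : ι) : ℤ ↪ ℤ × ι := ⟨fun j => (j, a), fun _ _ h => (Prod.ext_iff.1 h).1⟩

/-- The block-Laurent operator on `ℓ²(ℤ) ⊗ ℂ^ι` whose `(i, j)` block is `x_{j-i}`. -/
def laurent {ι : Type} [Fintype ι] (x : Symbol ι) : Ell2 (ℤ × ι) →L[ℂ] Ell2 (ℤ × ι) :=
  ∑ a : ι, ∑ b : ι,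
    embed (component a) ∘L laurentScalar (x.entry a b) ∘L
      ContinuousLinearMap.adjoint (embed (component b))

/-- The sites `1, 2, 3, …` of the right half-line, enumerated from the boundary. -/
def rightSites (ι : Type) : ℕ × ι ↪ ℤ × ι :=
  ⟨fun p => ((p.1 : ℤ) + 1, p.2), fun p q h => by
    simp only [Prod.ext_iff] at h; exact Prod.ext (by have := h.1; omega) h.2⟩

/-- The sites `0, -1, -2, …` of the left half-line, enumerated from the boundary. -/
def leftSites (ι : Type) : ℕ × ι ↪ ℤ × ι :=
  ⟨fun p => (-(p.1 : ℤ), p.2), fun p q h => by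
    simp only [Prod.ext_iff] at h; exact Prod.ext (by have := h.1; omega) h.2⟩

/-- The orthogonal projection of `ℓ²(β)` onto the functions supported on the range of `f`. -/
def siteProj {α β : Type} (f : α ↪ β) : Ell2 β →L[ℂ] Ell2 β :=
  embed f ∘L ContinuousLinearMap.adjoint (embed f)

/-- The semi-infinite block-Toeplitz operator `X` on `ℓ²(ℕ) ⊗ ℂ^ι`, whose `(i, j)` block is
`x_{j-i}`: the compression of the block-Laurent operator to the half-line. -/
def toeplitz {ι : Type} [Fintype ι] (x : Symbol ι) : Ell2 (ℕ × ι) →L[ℂ] Ell2 (ℕ × ι) :=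
  ContinuousLinearMap.adjoint (embed (rightSites ι)) ∘L laurent x ∘L embed (rightSites ι)

/-- The operator on `ℓ²(ℤ) ⊗ ℂ^ι` with semi-infinite boundary conditions: the two half-lines
`{1, 2, …}` and `{0, -1, …}` are kept, and all couplings between them are removed. -/
def sibc {ι : Type} [Fintype ι] (x : Symbol ι) : Ell2 (ℤ × ι) →L[ℂ] Ell2 (ℤ × ι) :=
  siteProj (rightSites ι) ∘L laurent x ∘L siteProj (rightSites ι) +
    siteProj (leftSites ι) ∘L laurent x ∘L siteProj (leftSites ι)

/-! ### The matrix entries of these operators -/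

theorem fourierCoeff_reflect_mul_fourier (f : C(UnitAddCircle, ℂ)) (i j : ℤ) :
    fourierCoeff (fun θ : UnitAddCircle => reflect f θ * fourier j θ) i =
      fourierCoeff f (j - i) := by
  unfold fourierCoeff
  rw [← integral_neg_eq_self]
  refine integral_congr_ae (Eventually.of_forall fun θ => ?_)
  have h1 : (fourier (-i) (-θ) : ℂ) * fourier j (-θ) = fourier (-(j - i)) θ := by
    rw [← fourier_add]
    simp only [fourier_apply]
    congr 2
    simp only [smul_neg, ← neg_smul]
    congr 1
    ring
  simp only [reflect, ContinuousMap.coe_mk, neg_neg, smul_eq_mul]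
  rw [← h1]
  ring

theorem laurentScalar_basisVec_apply (f : C(UnitAddCircle, ℂ)) (i j : ℤ) :
    laurentScalar f (basisVec j) i = fourierCoeff f (j - i) := by
  classical
  have hb : (fourierBasis (T := 1)).repr.symm (basisVec j) = fourierLp 2 j := by
    rw [basisVec_eq, HilbertBasis.repr_symm_single, coe_fourierBasis]
  have h : laurentScalar f (basisVec j) i
      = (fourierBasis (T := 1)).repr (mulOp (reflect f) (fourierLp 2 j)) i := by
    rw [← hb]; rfl
  rw [h, fourierBasis_repr, ← fourierCoeff_reflect_mul_fourier]
  refine congrFun (fourierCoeff_congr_ae ?_) i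
  have h1 := ContinuousLinearMap.coeFn_holder (r := 2) (ContinuousLinearMap.mul ℂ ℂ)
    (ContinuousMap.toLp ∞ (haarAddCircle (T := 1)) ℂ (reflect f)) (fourierLp (T := 1) 2 j)
  filter_upwards [h1, ContinuousMap.coeFn_toLp (p := ∞) (haarAddCircle (T := 1)) (𝕜 := ℂ)
    (reflect f), coeFn_fourierLp (T := 1) 2 j] with θ h1 h2 h3
  rw [← h2, ← h3]
  exact h1

theorem laurent_basisVec_apply {ι : Type} [Fintype ι] (x : Symbol ι) (i j : ℤ) (a b : ι) :
    laurent x (basisVec (j, b)) (i, a) = x.coeff (j - i) a b := by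
  classical
  have hadj : ∀ b' : ι, ContinuousLinearMap.adjoint (embed (component b')) (basisVec (j, b))
      = if b' = b then basisVec j else 0 := by
    intro b'
    ext k
    rw [adjoint_embed_apply]
    split_ifs with hb
    · subst hb
      by_cases hk : k = j
      · subst hk
        rw [basisVec_apply_self]
        exact basisVec_apply_self _
      · rw [basisVec_apply_ne hk]
        exact basisVec_apply_ne fun h => hk (Prod.ext_iff.1 h).1
    · exact basisVec_apply_ne fun h => hb (Prod.ext_iff.1 h).2
  have hemb : ∀ (a' : ι) (ψ : Ell2 ℤ), embed (component a') ψ (i, a)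
      = if a' = a then ψ i else 0 := by
    intro a' ψ
    rw [← inner_basisVec, ← ContinuousLinearMap.adjoint_inner_left]
    have : ContinuousLinearMap.adjoint (embed (component a')) (basisVec (i, a))
        = if a' = a then basisVec i else 0 := by
      ext k
      rw [adjoint_embed_apply]
      split_ifs with hb
      · subst hb
        by_cases hk : k = i
        · subst hk
          rw [basisVec_apply_self]
          exact basisVec_apply_self _
        · rw [basisVec_apply_ne hk]
          exact basisVec_apply_ne fun h => hk (Prod.ext_iff.1 h).1
      · exact basisVec_apply_ne fun h => hb (Prod.ext_iff.1 h).2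
    rw [this]
    split_ifs
    · exact inner_basisVec _ _
    · simp
  have hsum : laurent x (basisVec (j, b)) (i, a)
      = ∑ a' : ι, ∑ b' : ι, (embed (component a') (laurentScalar (x.entry a' b')
          (ContinuousLinearMap.adjoint (embed (component b')) (basisVec (j, b))))) (i, a) := by
    simp only [← inner_basisVec (i, a), laurent, _root_.sum_apply, inner_sum,
      ContinuousLinearMap.comp_apply]
  rw [hsum, Finset.sum_eq_single a, Finset.sum_eq_single b]
  · rw [hadj, if_pos rfl, hemb, if_pos rfl, laurentScalar_basisVec_apply]
    rfl
  · intro b' _ hb'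
    rw [hadj, if_neg hb']
    simp
  · simp
  · intro a' _ ha'
    exact Finset.sum_eq_zero fun b' _ => by rw [hemb, if_neg ha']
  · simp

theorem toeplitz_basisVec_apply {ι : Type} [Fintype ι] (x : Symbol ι) (i j : ℕ) (a b : ι) :
    toeplitz x (basisVec (j, b)) (i, a) = x.coeff ((j : ℤ) - (i : ℤ)) a b := by
  have h : toeplitz x (basisVec (j, b)) (i, a)
      = laurent x (basisVec ((j : ℤ) + 1, b)) ((i : ℤ) + 1, a) := by
    simp only [toeplitz, ContinuousLinearMap.comp_apply]
    rw [adjoint_embed_apply, embed_basisVec]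
    rfl
  rw [h, laurent_basisVec_apply]
  congr 1
  ring

theorem siteProj_basisVec_of_mem {α β : Type} (f : α ↪ β) (a : α) :
    siteProj f (basisVec (f a)) = basisVec (f a) := by
  have : ContinuousLinearMap.adjoint (embed f) (basisVec (f a)) = basisVec a := by
    ext k
    rw [adjoint_embed_apply]
    by_cases hk : k = a
    · rw [hk, basisVec_apply_self, basisVec_apply_self]
    · rw [basisVec_apply_ne hk, basisVec_apply_ne fun h => hk (f.injective h)]
  simp only [siteProj, ContinuousLinearMap.comp_apply]
  rw [this, embed_basisVec]

theorem siteProj_basisVec_of_notMem {α β : Type} (f : α ↪ β) {b : β} (hb : b ∉ Set.range f) :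
    siteProj f (basisVec b) = 0 := by
  have : ContinuousLinearMap.adjoint (embed f) (basisVec b) = 0 := by
    ext k
    rw [adjoint_embed_apply, basisVec_apply_ne fun h => hb ⟨k, h⟩]
    rfl
  simp only [siteProj, ContinuousLinearMap.comp_apply]
  rw [this, map_zero]

theorem inner_siteProj {α β : Type} (f : α ↪ β) (φ ψ : Ell2 β) :
    inner ℂ φ (siteProj f ψ) = inner ℂ (siteProj f φ) ψ := by
  simp only [siteProj, ContinuousLinearMap.comp_apply]
  rw [← ContinuousLinearMap.adjoint_inner_left, ContinuousLinearMap.adjoint_inner_right]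

theorem mem_range_rightSites {ι : Type} {p : ℤ × ι} :
    p ∈ Set.range (rightSites ι) ↔ 1 ≤ p.1 := by
  constructor
  · rintro ⟨q, rfl⟩
    change 1 ≤ (q.1 : ℤ) + 1
    omega
  · intro h
    exact ⟨((p.1 - 1).toNat, p.2), Prod.ext (by
      change (((p.1 - 1).toNat : ℕ) : ℤ) + 1 = p.1
      omega) rfl⟩

theorem mem_range_leftSites {ι : Type} {p : ℤ × ι} :
    p ∈ Set.range (leftSites ι) ↔ p.1 ≤ 0 := by
  constructor
  · rintro ⟨q, rfl⟩
    change -(q.1 : ℤ) ≤ 0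
    omega
  · intro h
    exact ⟨((-p.1).toNat, p.2), Prod.ext (by
      change -(((-p.1).toNat : ℕ) : ℤ) = p.1
      omega) rfl⟩

theorem sibc_basisVec_apply {ι : Type} [Fintype ι] (x : Symbol ι) (i j : ℤ) (a b : ι) :
    sibc x (basisVec (j, b)) (i, a) =
      if (1 ≤ i ↔ 1 ≤ j) then x.coeff (j - i) a b else 0 := by
  have hR : ∀ (k : ℤ) (c : ι), siteProj (rightSites ι) (basisVec (k, c))
      = if 1 ≤ k then basisVec (k, c) else 0 := by
    intro k c
    split_ifs with hk
    · obtain ⟨q, hq⟩ := mem_range_rightSites (p := (k, c)).2 hk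
      rw [← hq, siteProj_basisVec_of_mem]
    · exact siteProj_basisVec_of_notMem _ fun h => hk (mem_range_rightSites.1 h)
  have hL : ∀ (k : ℤ) (c : ι), siteProj (leftSites ι) (basisVec (k, c))
      = if 1 ≤ k then 0 else basisVec (k, c) := by
    intro k c
    split_ifs with hk
    · exact siteProj_basisVec_of_notMem _ fun h => by
        have := mem_range_leftSites.1 h
        simp only at this
        omega
    · obtain ⟨q, hq⟩ := mem_range_leftSites (p := (k, c)).2 (by simp only; omega)
      rw [← hq, siteProj_basisVec_of_mem]
  rw [← laurent_basisVec_apply, ← inner_basisVec, ← inner_basisVec]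
  simp only [sibc, _root_.add_apply, ContinuousLinearMap.comp_apply, inner_add_right]
  rw [inner_siteProj, inner_siteProj (leftSites ι), hR, hR, hL, hL]
  by_cases hi : 1 ≤ i <;> by_cases hj : 1 ≤ j <;> simp [hi, hj]

theorem Symbol.assoc_coeff {ι : Type} (x : Symbol ι) (r : ℤ) : x.assoc.coeff r = x.coeff (-r) := by
  ext a b
  have h := fourierCoeff_reflect_mul_fourier (x.entry a b) r 0
  simp only [Symbol.coeff, Matrix.of_apply]
  rw [zero_sub] at h
  rw [← h]
  congr 1
  funext θ
  simp [Symbol.entry, Symbol.assoc, reflect, AddCircle.toCircle_neg]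

/-! ### Limits of spectra and stability gaps -/

/-- The uniform limiting set of a sequence of sets of complex numbers: the limits of convergent
sequences `λ_n ∈ A_n`. -/
def uniformLimitingSet (A : ℕ → Set ℂ) : Set ℂ :=
  {z | ∃ s : ℕ → ℂ, (∀ n, s n ∈ A n) ∧ Tendsto s atTop (𝓝 z)}

/-- The stability gap `max Re σ(-iG)` of a dynamical matrix or operator `G`. -/
def stabilityGap {A : Type} [Ring A] [Algebra ℂ A] (G : A) : ℝ :=
  sSup (Complex.re '' spectrum ℂ ((-Complex.I) • G))

/-- For bounded operators on a nonzero Hilbert space the stability gap is an honest maximum. -/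
theorem isGreatest_stabilityGap_operator {H : Type} [NormedAddCommGroup H]
    [InnerProductSpace ℂ H] [CompleteSpace H] [Nontrivial H] (G : H →L[ℂ] H) :
    IsGreatest (Complex.re '' spectrum ℂ ((-Complex.I) • G)) (stabilityGap G) :=
  ((spectrum.isCompact _).image Complex.continuous_re).isGreatest_sSup
    ((spectrum.nonempty _).image _)

/-- For nonempty matrices the stability gap is an honest maximum. -/
theorem isGreatest_stabilityGap_matrix {n : Type} [Fintype n] [DecidableEq n] [Nonempty n]
    (G : Matrix n n ℂ) :
    IsGreatest (Complex.re '' spectrum ℂ ((-Complex.I) • G)) (stabilityGap G) :=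
  ((Matrix.finite_spectrum _).isCompact.image Complex.continuous_re).isGreatest_sSup
    ((spectrum.nonempty_of_isAlgClosed_of_finiteDimensional ℂ _).image _)

/-! ### Quadratic bosonic Lindbladians on a chain -/

/-- The internal index `(mode, component of the Nambu array (a, a†))` of one lattice site. -/
abbrev Nambu (d : ℕ) : Type := Fin d × Fin 2

/-- `τ₁ = 1_d ⊗ σ₁`. -/
def tau1 (d : ℕ) : Matrix (Nambu d) (Nambu d) ℂ := (1 : Matrix (Fin d) (Fin d) ℂ) ⊗ₖ !![0, 1; 1, 0]

/-- `τ₃ = 1_d ⊗ σ₃`. -/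
def tau3 (d : ℕ) : Matrix (Nambu d) (Nambu d) ℂ := (1 : Matrix (Fin d) (Fin d) ℂ) ⊗ₖ !![1, 0; 0, -1]

/-- The couplings of a one-dimensional bulk-translationally invariant quadratic bosonic
Lindbladian with `d` bosonic modes per site: coherent couplings `h r` and incoherent couplings
`m r` between the sites `j` and `j + r`, of finite range. -/
structure QBL (d : ℕ) where
  range : ℕ
  h : ℤ → Matrix (Nambu d) (Nambu d) ℂ
  m : ℤ → Matrix (Nambu d) (Nambu d) ℂ
  h_range : ∀ r : ℤ, (range : ℤ) < |r| → h r = 0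
  m_range : ∀ r : ℤ, (range : ℤ) < |r| → m r = 0
  h_adjoint : ∀ r, (h r)ᴴ = h (-r)
  m_adjoint : ∀ r, (m r)ᴴ = m (-r)
  h_nambu : ∀ r, h r = tau1 d * (h r).map (starRingEnd ℂ) * tau1 d
  /-- The Gorini-Kossakowski-Lindblad-Sudarshan matrix of every open chain is positive. -/
  m_pos : ∀ N : ℕ, (blockToeplitzOf m N).PosSemidef

/-- The couplings `g_r = τ₃ h_r - (i/2) τ₃ (m_r - τ₁ m_r^* τ₁)` of the dynamical matrix. -/
def QBL.g {d : ℕ} (L : QBL d) (r : ℤ) : Matrix (Nambu d) (Nambu d) ℂ :=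
  tau3 d * L.h r -
    (Complex.I / 2) • (tau3 d * (L.m r - tau1 d * (L.m r).map (starRingEnd ℂ) * tau1 d))

/-- The Hamiltonian matrix `H` of the open chain with `N` sites. -/
def QBL.hamiltonian {d : ℕ} (L : QBL d) (N : ℕ) :
    Matrix (Fin N × Nambu d) (Fin N × Nambu d) ℂ := blockToeplitzOf L.h N

/-- The matrix `M` of the dissipator of the open chain with `N` sites. -/
def QBL.gkls {d : ℕ} (L : QBL d) (N : ℕ) :
    Matrix (Fin N × Nambu d) (Fin N × Nambu d) ℂ := blockToeplitzOf L.m N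

/-- The dynamical matrix `G = τ₃ H - (i/2) τ₃ (M - τ₁ Mᵀ τ₁)` of the open chain with `N` sites. -/
def QBL.dynamicalOBC {d : ℕ} (L : QBL d) (N : ℕ) :
    Matrix (Fin N × Nambu d) (Fin N × Nambu d) ℂ :=
  ((1 : Matrix (Fin N) (Fin N) ℂ) ⊗ₖ tau3 d) * L.hamiltonian N -
    (Complex.I / 2) • (((1 : Matrix (Fin N) (Fin N) ℂ) ⊗ₖ tau3 d) *
      (L.gkls N - ((1 : Matrix (Fin N) (Fin N) ℂ) ⊗ₖ tau1 d) * (L.gkls N)ᵀ *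
        ((1 : Matrix (Fin N) (Fin N) ℂ) ⊗ₖ tau1 d)))

/-- The symbol `g(z) = ∑_{r=-R}^{R} g_r z^r`. -/
def QBL.symbol {d : ℕ} (L : QBL d) : Symbol (Nambu d) where
  toFun z := ∑ r ∈ Finset.Icc (-(L.range : ℤ)) L.range, ((z ^ r : Circle) : ℂ) • L.g r
  continuous_toFun := by
    refine continuous_finsetSum _ fun r _ => ?_
    have h : Continuous fun z : Circle => ((z ^ r : Circle) : ℂ) :=
      continuous_subtype_val.comp (continuous_zpow r)
    exact h.smul continuous_const

/-- The dynamical matrix of the system with semi-infinite boundary conditions. -/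
def QBL.dynamicalSIBC {d : ℕ} (L : QBL d) : Ell2 (ℤ × Nambu d) →L[ℂ] Ell2 (ℤ × Nambu d) :=
  sibc L.symbol

theorem QBL.g_eq_zero {d : ℕ} (L : QBL d) {r : ℤ} (hr : (L.range : ℤ) < |r|) : L.g r = 0 := by
  ext a b
  simp [QBL.g, L.h_range r hr, L.m_range r hr]

theorem QBL.symbol_coeff {d : ℕ} (L : QBL d) (r : ℤ) : L.symbol.coeff r = L.g r := by
  ext a b
  have h : (L.symbol.entry a b : UnitAddCircle → ℂ) =
      ∑ s ∈ Finset.Icc (-(L.range : ℤ)) L.range,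
        (fun θ : UnitAddCircle => L.g s a b * fourier s θ) := by
    funext θ
    simp only [Symbol.entry, QBL.symbol, ContinuousMap.coe_mk, Matrix.sum_apply, Finset.sum_apply]
    refine Finset.sum_congr rfl fun s _ => ?_
    rw [Matrix.smul_apply, smul_eq_mul, mul_comm, fourier_apply, AddCircle.toCircle_zsmul]
  have h2 : ∀ s : ℤ, fourierCoeff (fun θ : UnitAddCircle => L.g s a b * fourier s θ) r
      = if s = r then L.g s a b else 0 := by
    intro s
    rw [fourierCoeff.const_mul]
    have := congrFun (fourierCoeff_fourier (T := 1) s) r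
    rw [this, Pi.single_apply]
    by_cases hs : s = r
    · rw [if_pos hs, if_pos hs.symm, mul_one]
    · rw [if_neg hs, if_neg (Ne.symm hs), mul_zero]
  simp only [Symbol.coeff, Matrix.of_apply]
  rw [h, fourierCoeff.sum]
  · rw [Finset.sum_apply]
    simp only [h2, Finset.sum_ite_eq', Finset.mem_Icc]
    split_ifs with hr
    · rfl
    · rw [L.g_eq_zero]
      · rfl
      · by_contra hc
        exact hr (abs_le.1 (not_lt.1 hc))
  · intro s _
    exact (continuous_const.mul (map_continuous _)).integrable_of_hasCompactSupport
      (HasCompactSupport.of_compactSpace _)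

theorem one_kronecker_mul_blockToeplitzOf {ι : Type} [Fintype ι] (A : Matrix ι ι ℂ)
    (c : ℤ → Matrix ι ι ℂ) (N : ℕ) :
    ((1 : Matrix (Fin N) (Fin N) ℂ) ⊗ₖ A) * blockToeplitzOf c N =
      blockToeplitzOf (fun r => A * c r) N := by
  ext p q
  simp [Matrix.mul_apply, blockToeplitzOf, Fintype.sum_prod_type, Matrix.one_apply]

theorem blockToeplitzOf_mul_one_kronecker {ι : Type} [Fintype ι] (A : Matrix ι ι ℂ)
    (c : ℤ → Matrix ι ι ℂ) (N : ℕ) :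
    blockToeplitzOf c N * ((1 : Matrix (Fin N) (Fin N) ℂ) ⊗ₖ A) =
      blockToeplitzOf (fun r => c r * A) N := by
  ext p q
  simp [Matrix.mul_apply, blockToeplitzOf, Fintype.sum_prod_type_right, Matrix.one_apply]

theorem QBL.transpose_gkls {d : ℕ} (L : QBL d) (N : ℕ) :
    (L.gkls N)ᵀ = blockToeplitzOf (fun r => (L.m r).map (starRingEnd ℂ)) N := by
  ext p q
  have h := congrFun (congrFun (L.m_adjoint ((q.1 : ℤ) - p.1)) q.2) p.2
  simp only [QBL.gkls, blockToeplitzOf, Matrix.transpose_apply, Matrix.of_apply, Matrix.map_apply]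
  rw [show ((p.1 : ℤ) - q.1) = -((q.1 : ℤ) - p.1) by ring, ← h]
  rfl

/-- The dynamical matrix of the open chain is block-Toeplitz with blocks `g_{j-i}`. -/
theorem QBL.dynamicalOBC_eq {d : ℕ} (L : QBL d) (N : ℕ) :
    L.dynamicalOBC N = blockToeplitzOf L.g N := by
  rw [QBL.dynamicalOBC, L.transpose_gkls, one_kronecker_mul_blockToeplitzOf,
    blockToeplitzOf_mul_one_kronecker, QBL.gkls, QBL.hamiltonian,
    one_kronecker_mul_blockToeplitzOf]
  have : blockToeplitzOf L.m N -
      blockToeplitzOf (fun r => tau1 d * (L.m r).map (starRingEnd ℂ) * tau1 d) N =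
      blockToeplitzOf
        (fun r => L.m r - tau1 d * (L.m r).map (starRingEnd ℂ) * tau1 d) N := rfl
  rw [this, one_kronecker_mul_blockToeplitzOf]
  rfl

end BlockToeplitz

end

noncomputable section

namespace BlockToeplitz

/-! ### Isometric embeddings and site projections -/

/-! Suppose eigenvalues `s k` of `X_{N k}`, with `N k → ∞`, converge to `z`, where `z - X` and `z -
X̃` are both invertible, and take unit eigenvectors. A finite chain has two ends. Read from its left
end, `X_N` is a compression of `X`; read from its right end, it is a compression of `X̃`. The same
eigenvector is used in both pictures.

Invertibility of `z - X̃` forces each coordinate at a fixed distance from the right end to tend to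
zero (`tendsto_apply_zero_of_compression`): the coordinate is the pairing of `(z - X̃)ξ` with a
fixed vector `u`. Inside the chain `(z - X̃)ξ` equals `(z - s k)ξ`; outside, it meets only the tail
of `u`.

In the left picture, the eigenvalue equation for `X` fails only by the part of `Xξ` that leaks
beyond the right end. A monomial symbol makes this leak depend on finitely many coordinates near
that end, so it vanishes in the limit; density of trigonometric polynomials extends this to
continuous symbols (`tendsto_toeplitz_sub_siteProj`). Hence `(z - X)ξ → 0` with `‖ξ‖ = 1`,
contradicting invertibility of `z - X` (`mem_spectrum_toeplitz_of_tendsto`).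

For the gaps, the spectra of `X` and `X̃` lie in that of the semi-infinite operator, which is their
orthogonal sum. All finite-chain eigenvalues lie in a fixed disc, so a violation along infinitely
many `N` would have a limit point violating the bound. -/

theorem norm_embed {α β : Type} (f : α ↪ β) (φ : Ell2 α) : ‖embed f φ‖ = ‖φ‖ :=
  LinearIsometry.norm_map _ φ

theorem adjoint_embed_embed {α β : Type} (f : α ↪ β) (φ : Ell2 α) :
    ContinuousLinearMap.adjoint (embed f) (embed f φ) = φ := by
  refine ext_inner_left ℂ fun ψ => ?_
  rw [ContinuousLinearMap.adjoint_inner_right]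
  exact LinearIsometry.inner_map_map _ ψ φ

theorem norm_adjoint_embed_le {α β : Type} (f : α ↪ β) (φ : Ell2 β) :
    ‖ContinuousLinearMap.adjoint (embed f) φ‖ ≤ ‖φ‖ := by
  refine ((ContinuousLinearMap.adjoint (embed f)).le_opNorm φ).trans ?_
  rw [LinearIsometryEquiv.norm_map]
  refine mul_le_of_le_one_left (norm_nonneg φ) ?_
  exact LinearIsometry.norm_toContinuousLinearMap_le _

theorem norm_siteProj_le {α β : Type} (f : α ↪ β) (φ : Ell2 β) : ‖siteProj f φ‖ ≤ ‖φ‖ :=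
  (norm_embed f _).trans_le (norm_adjoint_embed_le f φ)

theorem norm_sub_siteProj_le {α β : Type} (f : α ↪ β) (φ : Ell2 β) :
    ‖φ - siteProj f φ‖ ≤ 2 * ‖φ‖ := by
  linarith [norm_sub_le φ (siteProj f φ), norm_siteProj_le f φ]

theorem embed_apply {α β : Type} (f : α ↪ β) (φ : Ell2 α) (a : α) : embed f φ (f a) = φ a := by
  rw [← adjoint_embed_apply, adjoint_embed_embed]

theorem embed_apply_of_notMem {α β : Type} (f : α ↪ β) (φ : Ell2 α) {b : β}
    (hb : b ∉ Set.range f) : embed f φ b = 0 := by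
  have h : ContinuousLinearMap.adjoint (embed f) (basisVec b) = 0 := by
    ext k
    rw [adjoint_embed_apply, basisVec_apply_ne fun h => hb ⟨k, h⟩]
    rfl
  rw [← inner_basisVec, ← ContinuousLinearMap.adjoint_inner_left, h, inner_zero_left]

theorem siteProj_apply {α β : Type} (f : α ↪ β) (φ : Ell2 β) (a : α) :
    siteProj f φ (f a) = φ (f a) := by
  rw [siteProj, ContinuousLinearMap.comp_apply, embed_apply, adjoint_embed_apply]

theorem hasSum_basisVec {α : Type} (φ : Ell2 α) : HasSum (fun a => φ a • basisVec a) φ := by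
  classical
  have h := lp.hasSum_single (E := fun _ : α => ℂ) (p := 2) (by simp) φ
  refine h.congr_fun ?_
  intro a
  rw [basisVec_eq, ← lp.single_smul]
  simp

theorem span_basisVec_closure_eq_top {α : Type} :
    (Submodule.span ℂ (Set.range (basisVec (α := α)))).topologicalClosure = ⊤ := by
  refine eq_top_iff.2 fun φ _ => ?_
  refine mem_closure_of_tendsto (hasSum_basisVec φ) (Eventually.of_forall fun s => ?_)
  exact Submodule.sum_mem _ fun a _ =>
    Submodule.smul_mem _ _ (Submodule.subset_span ⟨a, rfl⟩)

theorem clm_ext_basisVec {α : Type} {W : Type} [NormedAddCommGroup W] [NormedSpace ℂ W]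
    {S T : Ell2 α →L[ℂ] W} (h : ∀ a, S (basisVec a) = T (basisVec a)) : S = T := by
  refine ContinuousLinearMap.ext fun φ => ?_
  have h1 := (hasSum_basisVec φ).mapL S
  have h2 := (hasSum_basisVec φ).mapL T
  simp only [map_smul, h] at h1 h2
  exact h1.unique h2

/-- A uniformly bounded sequence of operators which tends to zero on a set with dense span tends
to zero strongly. -/
theorem tendsto_zero_of_dense_span {V W : Type} [NormedAddCommGroup V] [NormedSpace ℂ V]
    [NormedAddCommGroup W] [NormedSpace ℂ W] (F : ℕ → V →L[ℂ] W) (C : ℝ)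
    (hC : ∀ k v, ‖F k v‖ ≤ C * ‖v‖) {S : Set V}
    (hS : (Submodule.span ℂ S).topologicalClosure = ⊤)
    (h : ∀ v ∈ S, Tendsto (fun k => F k v) atTop (𝓝 0)) (v : V) :
    Tendsto (fun k => F k v) atTop (𝓝 0) := by
  have hspan : ∀ u ∈ Submodule.span ℂ S, Tendsto (fun k => F k u) atTop (𝓝 0) := by
    intro u hu
    induction hu using Submodule.span_induction with
    | mem u hu => exact h u hu
    | zero => simp
    | add u u' _ _ hu hu' => simpa using hu.add hu'
    | smul c u _ hu => simpa using hu.const_smul c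
  have hv : v ∈ closure (Submodule.span ℂ S : Set V) := by
    have : v ∈ (Submodule.span ℂ S).topologicalClosure := hS ▸ Submodule.mem_top
    exact this
  rw [Metric.tendsto_atTop]
  intro ε hε
  -- `|C| + 1` replaces `C`, whose sign is unknown, so that one can divide by it.
  have hC' : 0 < |C| + 1 := by positivity
  obtain ⟨u, hu, huv⟩ := Metric.mem_closure_iff.1 hv (ε / 2 / (|C| + 1)) (by positivity)
  obtain ⟨K, hK⟩ := Metric.tendsto_atTop.1 (hspan u hu) (ε / 2) (by positivity)
  refine ⟨K, fun k hk => ?_⟩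
  have h1 := hK k hk
  rw [dist_zero_right] at h1 ⊢
  rw [dist_eq_norm, lt_div_iff₀ hC'] at huv
  have h2 : ‖F k (v - u)‖ ≤ ‖v - u‖ * (|C| + 1) := by
    refine (hC k _).trans ?_
    nlinarith [norm_nonneg (v - u), le_abs_self C]
  have h3 : F k v = F k (v - u) + F k u := by rw [map_sub, sub_add_cancel]
  rw [h3]
  linarith [norm_add_le (F k (v - u)) (F k u)]

theorem tendsto_sub_siteProj {α : ℕ → Type} {β : Type} (f : ∀ k, α k ↪ β)
    (hf : ∀ b, ∀ᶠ k in atTop, b ∈ Set.range (f k)) (φ : Ell2 β) :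
    Tendsto (fun k => φ - siteProj (f k) φ) atTop (𝓝 0) := by
  refine tendsto_zero_of_dense_span (fun k => 1 - siteProj (f k)) 2
    (fun k v => norm_sub_siteProj_le (f k) v) span_basisVec_closure_eq_top ?_ φ
  rintro _ ⟨b, rfl⟩
  -- Once `b` lies in the range, the projection fixes its basis vector, so the sequence is
  -- eventually equal to zero.
  refine tendsto_const_nhds.congr' ?_
  filter_upwards [hf b] with k hk
  obtain ⟨a, ha⟩ := hk
  rw [← ha]
  exact (sub_eq_zero.2 (siteProj_basisVec_of_mem (f k) a).symm).symm

/-! ### Compressions -/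

/-- A finite matrix and an operator whose matrix entries extend those of the matrix: an eigenvector
of the matrix is a vector on which the compression of the operator acts by the eigenvalue. -/
theorem exists_eigenvector_of_mem_spectrum {α : Type} [Fintype α] [DecidableEq α]
    {M : Matrix α α ℂ} {s : ℂ} (hs : s ∈ spectrum ℂ M) :
    ∃ w : Ell2 α, ‖w‖ = 1 ∧ ∀ {β : Type} (f : α ↪ β) (T : Ell2 β →L[ℂ] Ell2 β),
      (∀ p q, T (basisVec (f q)) (f p) = M p q) → siteProj f (T (embed f w)) = s • embed f w := by
  rw [← Matrix.spectrum_toLin', ← Module.End.hasEigenvalue_iff_mem_spectrum] at hs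
  obtain ⟨v, hv⟩ := hs.exists_hasEigenvector
  have hMv : M *ᵥ v = s • v := by
    have := hv.apply_eq_smul
    rwa [Matrix.toLin'_apply] at this
  obtain ⟨u, hu⟩ : ∃ u : Ell2 α, ∀ a, u a = v a :=
    ⟨⟨v, memℓp_gen (hasSum_fintype _).summable⟩, fun _ => rfl⟩
  have hu0 : u ≠ 0 := fun h => hv.2 (funext fun a => by rw [← hu, h]; rfl)
  -- The vector is chosen before the embedding: the same eigenvector must later serve for both
  -- `firstSites` and `firstSitesRev`.
  have key : ∀ {β : Type} (f : α ↪ β) (T : Ell2 β →L[ℂ] Ell2 β),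
      (∀ p q, T (basisVec (f q)) (f p) = M p q) → siteProj f (T (embed f u)) = s • embed f u := by
    intro β f T hT
    rw [siteProj, ContinuousLinearMap.comp_apply, ← map_smul]
    congr 1
    ext p
    have hsum : u = ∑ q, u q • basisVec q := (hasSum_basisVec u).unique (hasSum_fintype _)
    have h1 : T (embed f u) = ∑ q, u q • T (basisVec (f q)) := by
      conv_lhs => rw [hsum]
      simp only [map_sum, map_smul, embed_basisVec]
    have h2 : (T (embed f u)) (f p) = ∑ q, u q * M p q := by
      rw [h1, ← inner_basisVec, inner_sum]
      refine Finset.sum_congr rfl fun q _ => ?_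
      rw [inner_smul_right, inner_basisVec, hT]
    rw [adjoint_embed_apply, h2]
    have h3 := congrFun hMv p
    simp only [Matrix.mulVec, dotProduct, Pi.smul_apply] at h3
    rw [lp.coeFn_smul, Pi.smul_apply, hu, ← h3]
    exact Finset.sum_congr rfl fun q _ => by rw [hu, mul_comm]
  refine ⟨((‖u‖ : ℂ)⁻¹) • u, ?_, fun f T hT => ?_⟩
  · exact norm_smul_inv_norm hu0
  · rw [map_smul, map_smul, map_smul, key f T hT, smul_comm]

/-! ### Dependence of the Laurent operator on its symbol -/

/-- Bounded linear dependence on the symbol is what allows approximation by trigonometric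
polynomials; it holds because reflection, passage to `L^∞`, multiplication and conjugation by the
Fourier isometry are each bounded and linear. -/
theorem exists_laurentScalar_clm : ∃ Λ : C(UnitAddCircle, ℂ) →L[ℂ] (Ell2 ℤ →L[ℂ] Ell2 ℤ),
    ∀ f, Λ f = laurentScalar f := by
  let e := (fourierBasis (T := 1)).repr
  let R : C(UnitAddCircle, ℂ) →L[ℂ] C(UnitAddCircle, ℂ) :=
    ⟨(ContinuousMap.compRightAlgHom ℂ ℂ
      (⟨fun θ => -θ, continuous_neg⟩ : C(UnitAddCircle, UnitAddCircle))).toLinearMap,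
      ContinuousMap.compRightAlgHom_continuous ℂ ℂ _⟩
  let A := ContinuousLinearMap.compL ℂ (Ell2 ℤ) (Lp ℂ 2 (haarAddCircle (T := 1))) (Ell2 ℤ)
    e.toContinuousLinearEquiv.toContinuousLinearMap
  let B := (ContinuousLinearMap.compL ℂ (Ell2 ℤ) (Lp ℂ 2 (haarAddCircle (T := 1)))
    (Lp ℂ 2 (haarAddCircle (T := 1)))).flip e.symm.toContinuousLinearEquiv.toContinuousLinearMap
  exact ⟨A ∘L B ∘L (ContinuousLinearMap.mul ℂ ℂ).holderL haarAddCircle ∞ 2 2 ∘L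
    ContinuousMap.toLp ∞ haarAddCircle ℂ ∘L R, fun f => rfl⟩

theorem laurentScalar_fourier_basisVec_apply (k i j : ℤ) :
    laurentScalar (fourier k) (basisVec j) i = if j - i = k then 1 else 0 := by
  rw [laurentScalar_basisVec_apply]
  have := congrFun (fourierCoeff_fourier (T := 1) k) (j - i)
  rw [this, Pi.single_apply]

/-! ### Finite chains inside the half-line -/

/-- The first `N` sites of the half-line. -/
def firstSites (ι : Type) (N : ℕ) : Fin N × ι ↪ ℕ × ι :=
  ⟨fun p => (p.1, p.2), fun p q h => by
    simp only [Prod.ext_iff] at h; exact Prod.ext (Fin.ext h.1) h.2⟩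

/-- The first `N` sites of the half-line, enumerated towards the boundary. -/
def firstSitesRev (ι : Type) (N : ℕ) : Fin N × ι ↪ ℕ × ι :=
  ⟨fun p => (p.1.rev, p.2), fun p q h => by
    simp only [Prod.ext_iff] at h; exact Prod.ext (Fin.rev_injective (Fin.ext h.1)) h.2⟩

theorem mem_range_firstSites {ι : Type} {N : ℕ} {p : ℕ × ι} :
    p ∈ Set.range (firstSites ι N) ↔ p.1 < N := by
  constructor
  · rintro ⟨q, rfl⟩
    exact q.1.2
  · exact fun h => ⟨(⟨p.1, h⟩, p.2), rfl⟩

theorem mem_range_firstSitesRev {ι : Type} {N : ℕ} {p : ℕ × ι} :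
    p ∈ Set.range (firstSitesRev ι N) ↔ p.1 < N := by
  constructor
  · rintro ⟨q, rfl⟩
    exact q.1.rev.2
  · exact fun h => ⟨(Fin.rev ⟨p.1, h⟩, p.2), Prod.ext (congrArg Fin.val (Fin.rev_rev ⟨p.1, h⟩)) rfl⟩

theorem toeplitz_firstSites {ι : Type} [Fintype ι] (x : Symbol ι) (N : ℕ) (p q : Fin N × ι) :
    toeplitz x (basisVec (firstSites ι N q)) (firstSites ι N p) = toeplitzMatrix x N p q :=
  toeplitz_basisVec_apply x p.1 q.1 p.2 q.2

/-- Reversing the chain changes the sign of `j - i`, and passing to `x̃` changes it back. This is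
how `X̃` sees the far end of the chain. -/
theorem toeplitz_assoc_firstSitesRev {ι : Type} [Fintype ι] (x : Symbol ι) (N : ℕ)
    (p q : Fin N × ι) :
    toeplitz x.assoc (basisVec (firstSitesRev ι N q)) (firstSitesRev ι N p)
      = toeplitzMatrix x N p q := by
  refine (toeplitz_basisVec_apply x.assoc p.1.rev q.1.rev p.2 q.2).trans ?_
  rw [Symbol.assoc_coeff]
  have hp := p.1.2
  have hq := q.1.2
  have h : -(((q.1.rev : ℕ) : ℤ) - ((p.1.rev : ℕ) : ℤ)) = (q.1 : ℤ) - (p.1 : ℤ) := by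
    simp only [Fin.val_rev]
    omega
  rw [h]
  rfl

/-! ### Hankel truncation -/

/-- The `(a, b)` component of a Toeplitz operator with scalar symbol. -/
def componentToeplitz {ι : Type} (a b : ι) (f : C(UnitAddCircle, ℂ)) :
    Ell2 (ℕ × ι) →L[ℂ] Ell2 (ℕ × ι) :=
  ContinuousLinearMap.adjoint (embed (rightSites ι)) ∘L (embed (component a) ∘L laurentScalar f ∘L
    ContinuousLinearMap.adjoint (embed (component b))) ∘L embed (rightSites ι)

/-- Reduces matrix symbols to scalar ones, for which the density of the monomials is available. -/
theorem toeplitz_eq_sum {ι : Type} [Fintype ι] (x : Symbol ι) :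
    toeplitz x = ∑ a, ∑ b, componentToeplitz a b (x.entry a b) := by
  ext1 φ
  simp only [toeplitz, laurent, componentToeplitz, ContinuousLinearMap.comp_apply,
    _root_.sum_apply, map_sum]

theorem componentToeplitz_fourier_basisVec_apply {ι : Type} (a b : ι) {k : ℤ} {i j : ℕ} (c d : ι)
    (h : (j : ℤ) - i ≠ k) : componentToeplitz a b (fourier k) (basisVec (j, c)) (i, d) = 0 := by
  classical
  have h1 : ContinuousLinearMap.adjoint (embed (component b)) (basisVec ((j : ℤ) + 1, c))
      = if c = b then basisVec ((j : ℤ) + 1) else 0 := by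
    ext l
    rw [adjoint_embed_apply]
    split_ifs with hc
    · subst hc
      by_cases hl : l = (j : ℤ) + 1
      · subst hl
        rw [basisVec_apply_self]
        exact basisVec_apply_self _
      · rw [basisVec_apply_ne hl]
        exact basisVec_apply_ne fun h => hl (Prod.ext_iff.1 h).1
    · exact basisVec_apply_ne fun h => hc (Prod.ext_iff.1 h).2.symm
  simp only [componentToeplitz, ContinuousLinearMap.comp_apply]
  rw [adjoint_embed_apply, embed_basisVec]
  change embed (component a) (laurentScalar (fourier k) (ContinuousLinearMap.adjoint
    (embed (component b)) (basisVec ((j : ℤ) + 1, c)))) ((i : ℤ) + 1, d) = 0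
  rw [h1]
  split_ifs with hc
  · by_cases hd : d = a
    · subst hd
      have := embed_apply (component d) (laurentScalar (fourier k) (basisVec ((j : ℤ) + 1)))
        ((i : ℤ) + 1)
      refine this.trans ?_
      rw [laurentScalar_fourier_basisVec_apply, if_neg]
      omega
    · refine embed_apply_of_notMem _ _ ?_
      rintro ⟨l, hl⟩
      exact hd (Prod.ext_iff.1 hl).2.symm
  · simp

theorem norm_componentToeplitz_apply_le {ι : Type} (a b : ι) (f : C(UnitAddCircle, ℂ))
    (φ : Ell2 (ℕ × ι)) : ‖componentToeplitz a b f φ‖ ≤ ‖laurentScalar f‖ * ‖φ‖ := by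
  simp only [componentToeplitz, ContinuousLinearMap.comp_apply]
  refine (norm_adjoint_embed_le _ _).trans ?_
  rw [norm_embed]
  refine ((laurentScalar f).le_opNorm _).trans ?_
  refine mul_le_mul_of_nonneg_left ?_ (norm_nonneg _)
  exact (norm_adjoint_embed_le _ _).trans_eq (norm_embed _ _)

/-- For a monomial symbol, the part of the image of a vector of the finite chain outside of the
chain is controlled by the components of that vector near the far end. -/
theorem norm_componentToeplitz_fourier_sub_le {ι : Type} [Fintype ι] (a b : ι) (k : ℤ) (N : ℕ)
    (w : Ell2 (Fin N × ι)) :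
    ‖componentToeplitz a b (fourier k) (embed (firstSites ι N) w) -
        siteProj (firstSites ι N) (componentToeplitz a b (fourier k) (embed (firstSites ι N) w))‖ ≤
      ∑ q ∈ Finset.range k.natAbs ×ˢ (Finset.univ : Finset ι),
        ‖embed (firstSitesRev ι N) w q‖ * (2 * ‖laurentScalar (fourier k)‖) := by
  classical
  set T : Ell2 (ℕ × ι) →L[ℂ] Ell2 (ℕ × ι) := componentToeplitz a b (fourier k)
  set D : Ell2 (ℕ × ι) →L[ℂ] Ell2 (ℕ × ι) := T - siteProj (firstSites ι N) ∘L T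
  have hD : ∀ φ, T φ - siteProj (firstSites ι N) (T φ) = D φ := fun φ => rfl
  have hDnorm : ∀ p, ‖D (basisVec p)‖ ≤ 2 * ‖laurentScalar (fourier k)‖ := by
    intro p
    rw [← hD]
    refine (norm_sub_siteProj_le _ _).trans ?_
    have := norm_componentToeplitz_apply_le a b (fourier k) (basisVec p)
    rw [orthonormal_basisVec.1 p, mul_one] at this
    linarith
  -- A site `j` is coupled only to `i = j - k`. If at least `|k|` sites of the chain lie beyond `j`,
  -- then `i ≤ N - 1`, so nothing leaks out.
  have hD0 : ∀ p : Fin N × ι, k.natAbs ≤ (p.1.rev : ℕ) → D (basisVec (firstSites ι N p)) = 0 := by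
    intro p hp
    rw [← hD, sub_eq_zero]
    ext ⟨i, c⟩
    by_cases hi : i < N
    · obtain ⟨q, hq⟩ := mem_range_firstSites (p := (i, c)).2 hi
      rw [← hq, siteProj_apply]
    · rw [siteProj, ContinuousLinearMap.comp_apply, embed_apply_of_notMem]
      · refine componentToeplitz_fourier_basisVec_apply a b p.2 c ?_
        have hp' := p.1.2
        rw [Fin.val_rev] at hp
        omega
      · exact fun h => hi (mem_range_firstSites.1 h)
  have hw : embed (firstSites ι N) w = ∑ p, w p • basisVec (firstSites ι N p) := by
    conv_lhs => rw [(hasSum_basisVec w).unique (hasSum_fintype _)]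
    simp only [map_sum, map_smul, embed_basisVec]
  rw [hD, hw, map_sum]
  refine (norm_sum_le _ _).trans ?_
  rw [← Finset.sum_filter_add_sum_filter_not Finset.univ
    (fun p : Fin N × ι => (p.1.rev : ℕ) < k.natAbs)]
  have hzero : ∑ p : Fin N × ι with ¬ (p.1.rev : ℕ) < k.natAbs,
      ‖D (w p • basisVec (firstSites ι N p))‖ = 0 := by
    refine Finset.sum_eq_zero fun p hp => ?_
    rw [map_smul, hD0 p (not_lt.1 (Finset.mem_filter.1 hp).2), smul_zero, norm_zero]
  rw [hzero, add_zero]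
  -- Counted from the far end, the surviving sites are `0, …, |k| - 1`: the final index set does not
  -- depend on `N`, so coordinatewise convergence suffices later.
  calc ∑ p : Fin N × ι with (p.1.rev : ℕ) < k.natAbs, ‖D (w p • basisVec (firstSites ι N p))‖
      ≤ ∑ p : Fin N × ι with (p.1.rev : ℕ) < k.natAbs,
          ‖embed (firstSitesRev ι N) w (firstSitesRev ι N p)‖ *
            (2 * ‖laurentScalar (fourier k)‖) := by
        refine Finset.sum_le_sum fun p _ => ?_
        rw [map_smul, norm_smul, embed_apply]
        exact mul_le_mul_of_nonneg_left (hDnorm _) (norm_nonneg _)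
    _ = ∑ q ∈ ({p : Fin N × ι | (p.1.rev : ℕ) < k.natAbs} : Finset _).map (firstSitesRev ι N),
          ‖embed (firstSitesRev ι N) w q‖ * (2 * ‖laurentScalar (fourier k)‖) := by
        rw [Finset.sum_map]
    _ ≤ _ := by
        refine Finset.sum_le_sum_of_subset_of_nonneg ?_ fun _ _ _ => by positivity
        intro q hq
        obtain ⟨p, hp, rfl⟩ := Finset.mem_map.1 hq
        exact Finset.mem_product.2
          ⟨Finset.mem_range.2 (Finset.mem_filter.1 hp).2, Finset.mem_univ _⟩

/-- If the components near the far end tend to zero, then so does the part outside of the chain of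
the image under a Toeplitz operator with continuous symbol. -/
theorem tendsto_toeplitz_sub_siteProj {ι : Type} [Fintype ι] (x : Symbol ι) (N : ℕ → ℕ)
    (w : ∀ k, Ell2 (Fin (N k) × ι)) (hw : ∀ k, ‖w k‖ ≤ 1)
    (h0 : ∀ q, Tendsto (fun k => embed (firstSitesRev ι (N k)) (w k) q) atTop (𝓝 0)) :
    Tendsto (fun k => toeplitz x (embed (firstSites ι (N k)) (w k)) -
      siteProj (firstSites ι (N k)) (toeplitz x (embed (firstSites ι (N k)) (w k))))
      atTop (𝓝 0) := by
  obtain ⟨Λ, hΛ⟩ := exists_laurentScalar_clm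
  have key : ∀ (a b : ι) (f : C(UnitAddCircle, ℂ)), Tendsto (fun k =>
      componentToeplitz a b f (embed (firstSites ι (N k)) (w k)) -
      siteProj (firstSites ι (N k)) (componentToeplitz a b f (embed (firstSites ι (N k)) (w k))))
      atTop (𝓝 0) := by
    intro a b f
    -- The vectors are frozen and the leak is regarded as a linear function of the symbol. It is
    -- bounded by `2 * ‖Λ‖` uniformly in `k`, so convergence needs checking only on monomials.
    let F : ℕ → C(UnitAddCircle, ℂ) →L[ℂ] Ell2 (ℕ × ι) := fun k =>
      (1 - siteProj (firstSites ι (N k))) ∘L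
        (ContinuousLinearMap.adjoint (embed (rightSites ι)) ∘L embed (component a)) ∘L
        ContinuousLinearMap.apply ℂ (Ell2 ℤ) (ContinuousLinearMap.adjoint (embed (component b))
          (embed (rightSites ι) (embed (firstSites ι (N k)) (w k)))) ∘L Λ
    have hF : ∀ k f, F k f = componentToeplitz a b f (embed (firstSites ι (N k)) (w k)) -
        siteProj (firstSites ι (N k))
          (componentToeplitz a b f (embed (firstSites ι (N k)) (w k))) := by
      intro k f
      simp only [F, componentToeplitz, ContinuousLinearMap.comp_apply, ContinuousLinearMap.apply_apply,
        hΛ]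
      rfl
    have hlim := tendsto_zero_of_dense_span F (2 * ‖Λ‖) ?_ (span_fourier_closure_eq_top (T := 1))
      ?_ f
    · simpa only [hF] using hlim
    · intro k f
      rw [hF]
      refine (norm_sub_siteProj_le _ _).trans ?_
      rw [mul_assoc]
      refine mul_le_mul_of_nonneg_left ?_ zero_le_two
      refine (norm_componentToeplitz_apply_le _ _ _ _).trans ?_
      rw [← hΛ, norm_embed]
      refine (mul_le_of_le_one_right (norm_nonneg _) (hw k)).trans (Λ.le_opNorm f)
    · rintro _ ⟨r, rfl⟩
      have hsum : Tendsto (fun k => ∑ q ∈ Finset.range r.natAbs ×ˢ (Finset.univ : Finset ι),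
          ‖embed (firstSitesRev ι (N k)) (w k) q‖ * (2 * ‖laurentScalar (fourier r)‖))
          atTop (𝓝 (∑ _q ∈ Finset.range r.natAbs ×ˢ (Finset.univ : Finset ι), 0)) := by
        refine tendsto_finsetSum _ fun q _ => ?_
        simpa using (h0 q).norm.mul_const (2 * ‖laurentScalar (fourier r)‖)
      rw [Finset.sum_const_zero] at hsum
      refine squeeze_zero_norm (fun k => ?_) hsum
      rw [hF]
      exact norm_componentToeplitz_fourier_sub_le a b r (N k) (w k)
  have hsum : Tendsto (fun k => ∑ a, ∑ b,
      (componentToeplitz a b (x.entry a b) (embed (firstSites ι (N k)) (w k)) -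
      siteProj (firstSites ι (N k))
        (componentToeplitz a b (x.entry a b) (embed (firstSites ι (N k)) (w k)))))
      atTop (𝓝 (∑ _a : ι, ∑ _b : ι, 0)) :=
    tendsto_finsetSum _ fun a _ => tendsto_finsetSum _ fun b _ => key a b _
  simp only [Finset.sum_const_zero] at hsum
  refine hsum.congr fun k => ?_
  simp only [toeplitz_eq_sum, _root_.sum_apply, map_sum, Finset.sum_sub_distrib]

/-! ### Limits of eigenvalues -/

/-- Approximate eigenvectors of compressions of an operator whose adjoint is onto, up to a
spectral parameter, tend to zero coordinatewise. -/
theorem tendsto_apply_zero_of_compression {α : ℕ → Type} {β : Type} (f : ∀ k, α k ↪ β)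
    (hf : ∀ b, ∀ᶠ k in atTop, b ∈ Set.range (f k)) (T : Ell2 β →L[ℂ] Ell2 β) {z : ℂ}
    (hz : z ∉ spectrum ℂ T) {s : ℕ → ℂ} (hs : Tendsto s atTop (𝓝 z)) (w : ∀ k, Ell2 (α k))
    (hw : ∀ k, ‖w k‖ ≤ 1)
    (hT : ∀ k, siteProj (f k) (T (embed (f k) (w k))) = s k • embed (f k) (w k)) (b : β) :
    Tendsto (fun k => embed (f k) (w k) b) atTop (𝓝 0) := by
  rw [spectrum.notMem_iff] at hz
  obtain ⟨B, hB⟩ := hz.exists_right_inv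
  obtain ⟨B', hB'⟩ := hz.exists_left_inv
  -- Pairing with `u` recovers the coordinate: `⟪e_b, ξ⟫ = ⟪e_b, B'(z - T)ξ⟫ = ⟪u, (z - T)ξ⟫`. In
  -- `h1` the compression equation replaces `⟪Pu, Tξ⟫` by `s k * ⟪u, ξ⟫`, where `P` is the site
  -- projection.
  set u : Ell2 β := ContinuousLinearMap.adjoint B' (basisVec b)
  have h1 : ∀ k, embed (f k) (w k) b
      = (z - s k) * inner ℂ u (embed (f k) (w k)) -
        inner ℂ (u - siteProj (f k) u) (T (embed (f k) (w k))) := by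
    intro k
    have h2 : embed (f k) (w k) = B' (z • embed (f k) (w k) - T (embed (f k) (w k))) :=
      (DFunLike.congr_fun hB' (embed (f k) (w k))).symm
    rw [← inner_basisVec]
    conv_lhs => rw [h2, ← ContinuousLinearMap.adjoint_inner_left]
    rw [inner_sub_left, ← inner_siteProj, hT, inner_smul_right, inner_sub_right, inner_smul_right]
    ring
  have h2 : Tendsto (fun k => ‖z - s k‖ * ‖u‖ + ‖u - siteProj (f k) u‖ * ‖T‖) atTop (𝓝 0) := by
    have ha : Tendsto (fun k => z - s k) atTop (𝓝 0) := by
      simpa using (tendsto_const_nhds (x := z)).sub hs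
    have hb := tendsto_sub_siteProj f hf u
    simpa using (ha.norm.mul_const ‖u‖).add (hb.norm.mul_const ‖T‖)
  refine squeeze_zero_norm (fun k => ?_) h2
  have hw' : ‖embed (f k) (w k)‖ ≤ 1 := (norm_embed _ _).trans_le (hw k)
  rw [h1]
  refine (norm_sub_le _ _).trans (add_le_add ?_ ?_)
  · rw [norm_mul]
    refine mul_le_mul_of_nonneg_left ?_ (norm_nonneg _)
    exact (norm_inner_le_norm _ _).trans (mul_le_of_le_one_right (norm_nonneg _) hw')
  · refine (norm_inner_le_norm _ _).trans (mul_le_mul_of_nonneg_left ?_ (norm_nonneg _))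
    exact (T.le_opNorm _).trans (mul_le_of_le_one_right (norm_nonneg _) hw')

/-- Limits of eigenvalues of growing finite block-Toeplitz matrices belong to the spectrum of one
of the two half-line operators. -/
theorem mem_spectrum_toeplitz_of_tendsto {ι : Type} [Fintype ι] [DecidableEq ι] (x : Symbol ι)
    {N : ℕ → ℕ} (hN : Tendsto N atTop atTop) {s : ℕ → ℂ} {z : ℂ} (hs : Tendsto s atTop (𝓝 z))
    (hmem : ∀ k, s k ∈ spectrum ℂ (toeplitzMatrix x (N k))) :
    z ∈ spectrum ℂ (toeplitz x) ∪ spectrum ℂ (toeplitz x.assoc) := by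
  by_contra hz
  rw [Set.mem_union, not_or] at hz
  choose w hw1 hw using fun k => exists_eigenvector_of_mem_spectrum (hmem k)
  have hrev : ∀ q, Tendsto (fun k => embed (firstSitesRev ι (N k)) (w k) q) atTop (𝓝 0) :=
    tendsto_apply_zero_of_compression (fun k => firstSitesRev ι (N k))
      (fun q => by simpa only [mem_range_firstSitesRev] using hN.eventually_gt_atTop q.1)
      (toeplitz x.assoc) hz.2 hs w (fun k => (hw1 k).le)
      (fun k => hw k _ _ (toeplitz_assoc_firstSitesRev x (N k)))
  have hout := tendsto_toeplitz_sub_siteProj x N w (fun k => (hw1 k).le) hrev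
  obtain ⟨B, hB⟩ := (spectrum.notMem_iff.1 hz.1).exists_left_inv
  have hlim : Tendsto (fun k => ‖B‖ * (‖z - s k‖ +
      ‖toeplitz x (embed (firstSites ι (N k)) (w k)) - siteProj (firstSites ι (N k))
        (toeplitz x (embed (firstSites ι (N k)) (w k)))‖)) atTop (𝓝 0) := by
    have ha : Tendsto (fun k => z - s k) atTop (𝓝 0) := by
      simpa using (tendsto_const_nhds (x := z)).sub hs
    simpa using (ha.norm.add hout.norm).const_mul ‖B‖
  -- The left inverse `B` bounds `‖ξ‖ = 1` by a quantity tending to zero.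
  refine absurd (ge_of_tendsto' hlim fun k => ?_) (not_le.2 one_pos)
  set ξ := embed (firstSites ι (N k)) (w k) with hξ
  have hξ1 : ‖ξ‖ = 1 := (norm_embed _ _).trans (hw1 k)
  have hcomp : siteProj (firstSites ι (N k)) (toeplitz x ξ) = s k • ξ :=
    hw k _ _ (toeplitz_firstSites x (N k))
  have h2 : ξ = B (z • ξ - toeplitz x ξ) := (DFunLike.congr_fun hB ξ).symm
  calc (1 : ℝ) = ‖B (z • ξ - toeplitz x ξ)‖ := by rw [← h2, hξ1]
    _ ≤ ‖B‖ * ‖z • ξ - toeplitz x ξ‖ := B.le_opNorm _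
    _ ≤ _ := by
      refine mul_le_mul_of_nonneg_left ?_ (norm_nonneg _)
      have h3 : z • ξ - toeplitz x ξ = (z - s k) • ξ -
          (toeplitz x ξ - siteProj (firstSites ι (N k)) (toeplitz x ξ)) := by
        rw [hcomp, sub_smul]
        abel
      rw [h3]
      refine (norm_sub_le _ _).trans_eq ?_
      rw [norm_smul, hξ1, mul_one]

/-! ### Semi-infinite boundary conditions -/

/-- The spectrum of a restriction to a reducing subspace is contained in the full spectrum. -/
theorem spectrum_subset_of_reducing {α β : Type} (f : α ↪ β) (S : Ell2 α →L[ℂ] Ell2 α)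
    (T : Ell2 β →L[ℂ] Ell2 β) (h1 : T ∘L embed f = embed f ∘L S)
    (h2 : ContinuousLinearMap.adjoint (embed f) ∘L T
      = S ∘L ContinuousLinearMap.adjoint (embed f)) :
    spectrum ℂ S ⊆ spectrum ℂ T := by
  intro z hz
  contrapose! hz
  rw [spectrum.notMem_iff] at hz ⊢
  obtain ⟨u, hu⟩ := hz
  have hright : ∀ φ, z • (↑u⁻¹ : Ell2 β →L[ℂ] Ell2 β) φ - T ((↑u⁻¹ : Ell2 β →L[ℂ] Ell2 β) φ)
      = φ := fun φ => DFunLike.congr_fun (hu ▸ u.mul_inv) φ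
  have hleft : ∀ φ, (↑u⁻¹ : Ell2 β →L[ℂ] Ell2 β) (z • φ - T φ) = φ :=
    fun φ => DFunLike.congr_fun (hu ▸ u.inv_mul) φ
  have h1' : ∀ φ, T (embed f φ) = embed f (S φ) := DFunLike.congr_fun h1
  have h2' : ∀ φ, ContinuousLinearMap.adjoint (embed f) (T φ)
      = S (ContinuousLinearMap.adjoint (embed f) φ) := DFunLike.congr_fun h2
  -- The inverse of `z - S` is the compression of that of `z - T`: `h2` makes it a right inverse and
  -- `h1` a left inverse.
  refine ⟨⟨_, ContinuousLinearMap.adjoint (embed f) ∘L (↑u⁻¹ : Ell2 β →L[ℂ] Ell2 β) ∘L embed f,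
    ?_, ?_⟩, rfl⟩
  · refine ContinuousLinearMap.ext fun φ => ?_
    change z • ContinuousLinearMap.adjoint (embed f) _ - S (ContinuousLinearMap.adjoint (embed f) _)
      = φ
    rw [← h2', ← map_smul, ← map_sub]
    exact (congrArg _ (hright _)).trans (adjoint_embed_embed f φ)
  · refine ContinuousLinearMap.ext fun φ => ?_
    change ContinuousLinearMap.adjoint (embed f)
      ((↑u⁻¹ : Ell2 β →L[ℂ] Ell2 β) (embed f (z • φ - S φ))) = φ
    rw [map_sub, map_smul, ← h1', hleft, adjoint_embed_embed]

theorem adjoint_embed_comp_embed_of_disjoint {α α' β : Type} (f : α ↪ β) (g : α' ↪ β)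
    (h : ∀ a b, f a ≠ g b) : ContinuousLinearMap.adjoint (embed f) ∘L embed g = 0 := by
  refine ContinuousLinearMap.ext fun φ => ?_
  ext a
  rw [ContinuousLinearMap.comp_apply, adjoint_embed_apply, embed_apply_of_notMem]
  · rfl
  · rintro ⟨b, hb⟩
    exact h a b hb.symm

theorem rightSites_ne_leftSites {ι : Type} (p q : ℕ × ι) : rightSites ι p ≠ leftSites ι q := by
  intro h
  have h1 := mem_range_rightSites.1 ⟨p, rfl⟩
  have h2 := mem_range_leftSites.1 ⟨q, rfl⟩
  rw [h] at h1
  omega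

/-- The compression of the block-Laurent operator to the left half-line is the associated
block-Toeplitz operator. -/
theorem toeplitz_assoc_eq {ι : Type} [Fintype ι] (x : Symbol ι) :
    toeplitz x.assoc =
      ContinuousLinearMap.adjoint (embed (leftSites ι)) ∘L laurent x ∘L embed (leftSites ι) := by
  refine clm_ext_basisVec fun ⟨j, b⟩ => ?_
  ext ⟨i, a⟩
  rw [toeplitz_basisVec_apply, Symbol.assoc_coeff, ContinuousLinearMap.comp_apply,
    adjoint_embed_apply, ContinuousLinearMap.comp_apply, embed_basisVec]
  refine Eq.trans ?_ (laurent_basisVec_apply x (-(i : ℤ)) (-(j : ℤ)) a b).symm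
  congr 1
  ring_nf

theorem sibc_eq {ι : Type} [Fintype ι] (x : Symbol ι) :
    sibc x = embed (rightSites ι) ∘L toeplitz x ∘L
        ContinuousLinearMap.adjoint (embed (rightSites ι)) +
      embed (leftSites ι) ∘L toeplitz x.assoc ∘L
        ContinuousLinearMap.adjoint (embed (leftSites ι)) := by
  rw [toeplitz_assoc_eq]
  rfl

/-- Each half-line reduces the decoupled operator, because the ranges of the two embeddings are
orthogonal. -/
theorem spectrum_toeplitz_union_subset_sibc {ι : Type} [Fintype ι] (x : Symbol ι) :
    spectrum ℂ (toeplitz x) ∪ spectrum ℂ (toeplitz x.assoc) ⊆ spectrum ℂ (sibc x) := by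
  have hRL : ∀ φ, ContinuousLinearMap.adjoint (embed (rightSites ι)) (embed (leftSites ι) φ) = 0 :=
    DFunLike.congr_fun (adjoint_embed_comp_embed_of_disjoint _ _ rightSites_ne_leftSites)
  have hLR : ∀ φ, ContinuousLinearMap.adjoint (embed (leftSites ι)) (embed (rightSites ι) φ) = 0 :=
    DFunLike.congr_fun (adjoint_embed_comp_embed_of_disjoint _ _
      fun p q => (rightSites_ne_leftSites q p).symm)
  rw [sibc_eq]
  refine Set.union_subset (spectrum_subset_of_reducing (rightSites ι) _ _ ?_ ?_)
    (spectrum_subset_of_reducing (leftSites ι) _ _ ?_ ?_) <;>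
  · ext1 φ
    simp only [ContinuousLinearMap.comp_apply, _root_.add_apply, map_add, adjoint_embed_embed, hRL,
      hLR, map_zero, add_zero, zero_add]

/-! ### Stability gaps -/

/-- Compression does not increase the norm. The bound is uniform in `N` and supplies the compactness
for extracting convergent eigenvalues. -/
theorem norm_le_of_mem_spectrum_toeplitzMatrix {ι : Type} [Fintype ι] [DecidableEq ι]
    (x : Symbol ι) {N : ℕ} {s : ℂ} (hs : s ∈ spectrum ℂ (toeplitzMatrix x N)) :
    ‖s‖ ≤ ‖toeplitz x‖ := by
  obtain ⟨w, hw1, hw⟩ := exists_eigenvector_of_mem_spectrum hs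
  have h := congrArg norm (hw _ _ (toeplitz_firstSites x N))
  have hξ1 : ‖embed (firstSites ι N) w‖ = 1 := (norm_embed _ _).trans hw1
  rw [norm_smul, hξ1, mul_one] at h
  rw [← h]
  refine (norm_siteProj_le _ _).trans (((toeplitz x).le_opNorm _).trans_eq ?_)
  rw [hξ1, mul_one]

theorem spectrum_neg_I_smul {A : Type} [Ring A] [Algebra ℂ A] (G : A) :
    spectrum ℂ ((-Complex.I) • G) = (fun z => -Complex.I * z) '' spectrum ℂ G :=
  spectrum.unit_smul_eq_smul G (Units.mk0 (-Complex.I) (neg_ne_zero.2 Complex.I_ne_zero))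

/-- Stability gaps of finite open chains are asymptotically bounded by the gap with semi-infinite
boundary conditions. -/
theorem eventually_stabilityGap_toeplitzMatrix_lt {ι : Type} [Fintype ι] [DecidableEq ι]
    [Nonempty ι] (x : Symbol ι) {c : ℝ} (hc : stabilityGap (sibc x) < c) :
    ∀ᶠ N in atTop, stabilityGap (toeplitzMatrix x N) < c := by
  by_contra hcon
  rw [not_eventually] at hcon
  -- Positivity of `N` is added because the empty chain has empty spectrum, where the gap is the
  -- default `sSup ∅ = 0` and is not attained.
  obtain ⟨N, hNmono, hN⟩ := extraction_of_frequently_atTop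
    (hcon.and_eventually (eventually_gt_atTop 0))
  have hex : ∀ k, ∃ s ∈ spectrum ℂ (toeplitzMatrix x (N k)), c ≤ (-Complex.I * s).re := by
    intro k
    have : Nonempty (Fin (N k)) := ⟨⟨0, (hN k).2⟩⟩
    have h := (isGreatest_stabilityGap_matrix (toeplitzMatrix x (N k))).1
    rw [spectrum_neg_I_smul] at h
    obtain ⟨_, ⟨s, hs, rfl⟩, hre⟩ := h
    exact ⟨s, hs, (not_lt.1 (hN k).1).trans_eq hre.symm⟩
  choose s hs hsc using hex
  obtain ⟨z, -, φ, hφ, hz⟩ := tendsto_subseq_of_bounded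
    (Metric.isBounded_closedBall (x := (0 : ℂ)) (r := ‖toeplitz x‖)) (x := s)
    fun k => mem_closedBall_zero_iff.2 (norm_le_of_mem_spectrum_toeplitzMatrix x (hs k))
  have hmem : z ∈ spectrum ℂ (sibc x) := spectrum_toeplitz_union_subset_sibc x
    (mem_spectrum_toeplitz_of_tendsto x (N := N ∘ φ)
      (hNmono.tendsto_atTop.comp hφ.tendsto_atTop) hz fun k => hs (φ k))
  have hre : c ≤ (-Complex.I * z).re :=
    ge_of_tendsto' (((Complex.continuous_re.comp (continuous_const_mul _)).tendsto z).comp hz)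
      fun k => hsc (φ k)
  -- The gap of the semi-infinite operator is an attained maximum only on a nonzero space; this is
  -- where the index type must be nonempty.
  have : Nontrivial (Ell2 (ℤ × ι)) :=
    ⟨⟨basisVec (0, Classical.arbitrary ι), 0, orthonormal_basisVec.ne_zero _⟩⟩
  have hle := (isGreatest_stabilityGap_operator (sibc x)).2
    ⟨-Complex.I * z, by rw [spectrum_neg_I_smul]; exact ⟨z, hmem, rfl⟩, rfl⟩
  linarith

theorem QBL.dynamicalOBC_eq_toeplitzMatrix {d : ℕ} (L : QBL d) (N : ℕ) :
    L.dynamicalOBC N = toeplitzMatrix L.symbol N := by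
  rw [L.dynamicalOBC_eq, toeplitzMatrix, funext L.symbol_coeff]

theorem QBL.eventually_stabilityGap_lt {d : ℕ} (hd : 0 < d) (L : QBL d) {c : ℝ}
    (hc : stabilityGap L.dynamicalSIBC < c) :
    ∀ᶠ N in atTop, stabilityGap (L.dynamicalOBC N) < c := by
  have : Nonempty (Nambu d) := ⟨(⟨0, hd⟩, 0)⟩
  simpa only [L.dynamicalOBC_eq_toeplitzMatrix] using
    eventually_stabilityGap_toeplitzMatrix_lt L.symbol hc

end BlockToeplitz

end

theorem mainTheorem1 :
    (∀ (m : ℕ) (x : BlockToeplitz.Symbol (Fin m)),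
      BlockToeplitz.uniformLimitingSet
          (fun n => spectrum ℂ (BlockToeplitz.toeplitzMatrix x (n + 1))) ⊆
        spectrum ℂ (BlockToeplitz.toeplitz x) ∪ spectrum ℂ (BlockToeplitz.toeplitz x.assoc)) ∧
    (∀ (d : ℕ), 0 < d → ∀ L : BlockToeplitz.QBL d,
      Filter.limsup
          (fun N : ℕ => (BlockToeplitz.stabilityGap (L.dynamicalOBC N) : EReal)) Filter.atTop ≤
        (BlockToeplitz.stabilityGap L.dynamicalSIBC : EReal) ∧
      ∀ Δ : ℝ,
        Filter.Tendsto (fun N : ℕ => BlockToeplitz.stabilityGap (L.dynamicalOBC N))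
          Filter.atTop (nhds Δ) →
        Δ ≤ BlockToeplitz.stabilityGap L.dynamicalSIBC) := by
  refine ⟨fun m x z hz => ?_, fun d hd L => ⟨?_, fun Δ hΔ => ?_⟩⟩
  · obtain ⟨s, hs, hlim⟩ := hz
    exact BlockToeplitz.mem_spectrum_toeplitz_of_tendsto x (Filter.tendsto_add_atTop_nat 1) hlim hs
  -- It suffices to bound the upper limit by every real `c` above the semi-infinite gap; in `EReal`
  -- no separate boundedness argument is needed.
  · refine EReal.le_of_forall_lt_iff_le.1 fun c hc => ?_
    refine Filter.limsup_le_of_le (by isBoundedDefault) ?_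
    filter_upwards [L.eventually_stabilityGap_lt hd (EReal.coe_lt_coe_iff.1 hc)] with N hN
    exact EReal.coe_le_coe_iff.2 hN.le
  · refine le_of_forall_gt_imp_ge_of_dense fun c hc => ?_
    exact le_of_tendsto hΔ ((L.eventually_stabilityGap_lt hd hc).mono fun N hN => hN.le)
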